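/- Let $\mathbb{G}$ be a homogeneous Lie group: $\mathbb{R}^N$ with a Lie group law for which, for some $\nu_1,\dots,\nu_N>0$, every dilation $D_\lambda(x)=(\lambda^{\nu_1}x_1,\dots,\lambda^{\nu_N}x_N)$, $\lambda>0$, is a group automorphism. Let $dx$ be Lebesgue measure (the Haar measure of $\mathbb{G}$), and assume that the homogeneous dimension $Q=\nu_1+\dots+\nu_N$ satisfies $Q\ge 3$. Let $|\cdot|$ be a homogeneous quasi-norm on $\mathbb{G}$, that is, a continuous function $\mathbb{G}\to[0,\infty)$ with $|x^{-1}|=|x|$, $|D_\lambda(x)|=\lambda|x|$ for $\lambda>0$, and $|x|=0$ if and only if $x=0$. For measurable $u:\mathbb{G}\to\mathbb{R}$ put $$[u]_{s,p}=\left(\int_{\mathbb{G}}\int_{\mathbb{G}}\frac{|u(x)-u(y)|^p}{|y^{-1}x|^{Q+sp}}\,dx\,dy\right)^{1/p},\qquad W^{s,p}(\mathbb{G})=\{u\in L^p(\mathbb{G}):[u]_{s,p}<\infty\}.$$ **Theorem 3.1.** Let $p>1$, $s\in(0,1)$ and $0\le\beta<sp<Q$. Then there is a constant $C>0$, depending only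 on $\mathbb{G}$ (with its dilations), $|\cdot|$, $p$, $s$ and $\beta$, such that for all $u\in W^{s,p}(\mathbb{G})\setminus\{0\}$ with $|x|^{-\frac{sp-\beta}{p}}u\in L^p(\mathbb{G})$, writing $$\mathcal N(u)=\left\|\frac{u}{|x|^{\frac{sp-\beta}{p}}}\right\|_{L^p(\mathbb{G})}^p,$$ one has the weighted logarithmic Hardy inequality $$\int_{\mathbb{G}}\frac{|u(x)|^p}{|x|^{sp-\beta}\,\mathcal N(u)}\,\log\left(\frac{|x|^{(Q-sp)\left(1-\frac{\beta}{sp-\beta}\right)}|u(x)|^p}{\mathcal N(u)}\right)dx\le\frac{Q-\beta}{sp-\beta}\,\log\left(C\,\frac{[u]_{s,p}^p}{\mathcal N(u)}\right).$$ Here $0\log 0=0$. The positive part of the integrand on the left is integrable, and the left-hand side is the Lebesgue integral with values in $[-\infty,\infty)$. -/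

import Mathlib

open MeasureTheory
open scoped ENNReal Manifold ContDiff

/-- The underlying manifold `ℝ^N`. It carries no multiplication of its own; the group law of a
Lie group on `ℝ^N` is supplied by a `Group` instance. -/
abbrev RSpace (N : ℕ) : Type := EuclideanSpace ℝ (Fin N)

/-- The dilation `D_r(x) = (r^{ν₁} x₁, …, r^{ν_N} x_N)` of `ℝ^N` with weights `ν`. -/
noncomputable def dilation {N : ℕ} (ν : Fin N → ℝ) (r : ℝ) (x : RSpace N) : RSpace N :=
  WithLp.toLp 2 (fun i => r ^ (ν i) * x i)

/-- `ℝ^N` with the given group law is a homogeneous Lie group with respect to the dilations of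
weights `ν`: the law is smooth, the weights are positive, and each dilation `D_r`, `r > 0` (a linear
bijection with inverse `D_{1/r}`), is a group automorphism. -/
structure IsHomogeneousLieGroup (N : ℕ) [Group (RSpace N)] (ν : Fin N → ℝ) : Prop where
  lieGroup : LieGroup 𝓘(ℝ, RSpace N) ∞ (RSpace N)
  weight_pos : ∀ i, 0 < ν i
  dilation_mul : ∀ r : ℝ, 0 < r → ∀ x y : RSpace N,
    dilation ν r (x * y) = dilation ν r x * dilation ν r y

/-- The homogeneous dimension `Q = ν₁ + … + ν_N`. -/
def homogeneousDim {N : ℕ} (ν : Fin N → ℝ) : ℝ := ∑ i, ν i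

/-- `m = |·|` is a homogeneous quasi-norm. -/
structure IsHomogeneousQuasiNorm {N : ℕ} [Group (RSpace N)] (ν : Fin N → ℝ)
    (m : RSpace N → ℝ) : Prop where
  continuous : Continuous m
  nonneg : ∀ x, 0 ≤ m x
  inv : ∀ x, m x⁻¹ = m x
  dilation : ∀ r : ℝ, 0 < r → ∀ x, m (dilation ν r x) = r * m x
  eq_zero_iff : ∀ x, m x = 0 ↔ x = 0

/-- The Gagliardo quasi-seminorm
`[u]_{s,p} = (∫∫ |u(x) - u(y)|^p / |y⁻¹ x|^{Q+sp} dx dy)^{1/p}`, with values in `[0, ∞]`.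
Here and below `dx` is Lebesgue measure on `ℝ^N`, the Haar measure of a homogeneous Lie group. -/
noncomputable def gagliardoSeminorm {N : ℕ} [Group (RSpace N)] (ν : Fin N → ℝ)
    (m : RSpace N → ℝ) (s p : ℝ) (u : RSpace N → ℝ) : ℝ≥0∞ :=
  (∫⁻ y : RSpace N, ∫⁻ x : RSpace N,
    ENNReal.ofReal (|u x - u y| ^ p / m (y⁻¹ * x) ^ (homogeneousDim ν + s * p))) ^ (1 / p)

/-- `u ∈ W^{s,p}`: `u ∈ L^p` and `[u]_{s,p} < ∞`. -/
def MemFracSobolev {N : ℕ} [Group (RSpace N)] (ν : Fin N → ℝ)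
    (m : RSpace N → ℝ) (s p : ℝ) (u : RSpace N → ℝ) : Prop :=
  MemLp u (ENNReal.ofReal p) volume ∧ gagliardoSeminorm ν m s p u < ⊤

/-- The function `|x|^{-(sp-β)/p} u(x)`. -/
noncomputable def weightedFun {N : ℕ} (m : RSpace N → ℝ) (s p β : ℝ) (u : RSpace N → ℝ) :
    RSpace N → ℝ :=
  fun x => u x / m x ^ ((s * p - β) / p)

/-- `‖ |x|^{-(sp-β)/p} u ‖_{L^p}^p`, as a real number (meaningful when the norm is finite). -/
noncomputable def weightedNormPow {N : ℕ} (m : RSpace N → ℝ) (s p β : ℝ) (u : RSpace N → ℝ) : ℝ :=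
  (eLpNorm (weightedFun m s p β u) (ENNReal.ofReal p) volume).toReal ^ p

/-- The integrand on the left-hand side of the weighted logarithmic Hardy inequality. Where
`u x = 0` it vanishes (the convention `0 log 0 = 0`). -/
noncomputable def logHardyIntegrand {N : ℕ} (ν : Fin N → ℝ) (m : RSpace N → ℝ) (s p β : ℝ)
    (u : RSpace N → ℝ) : RSpace N → ℝ :=
  fun x =>
    (|u x| ^ p / m x ^ (s * p - β)) / weightedNormPow m s p β u *
      Real.log (m x ^ ((homogeneousDim ν - s * p) * (1 - β / (s * p - β))) * |u x| ^ p /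
        weightedNormPow m s p β u)

/-- The Lebesgue integral `∫ f⁺ - ∫ f⁻` of a measurable function, with values in `[-∞, ∞]`;
meaningful as soon as one of the two parts is finite. -/
noncomputable def extendedIntegral {N : ℕ} (f : RSpace N → ℝ) : EReal :=
  ((∫⁻ x, ENNReal.ofReal (f x) : ℝ≥0∞) : EReal) - ((∫⁻ x, ENNReal.ofReal (-f x) : ℝ≥0∞) : EReal)

/-- For an integrable function the extended integral is the ordinary integral. -/
theorem extendedIntegral_eq_integral {N : ℕ} (f : RSpace N → ℝ) (hf : Integrable f) :
    extendedIntegral f = ((∫ x, f x : ℝ) : EReal) := by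
  have h1 : (∫⁻ x, ENNReal.ofReal (f x)) ≠ ⊤ := hf.lintegral_lt_top.ne
  have h2 : (∫⁻ x, ENNReal.ofReal (-f x)) ≠ ⊤ := hf.neg.lintegral_lt_top.ne
  rw [integral_eq_lintegral_pos_part_sub_lintegral_neg_part hf, extendedIntegral, EReal.coe_sub,
    EReal.coe_ennreal_toReal h1, EReal.coe_ennreal_toReal h2]

/-! Put `a = sp`, `r = (Q - β)/(Q - a)`, `κ = (Q - a)/(a - β)`. The proof combines Jensen's
inequality for the logarithm with the fractional Hardy–Sobolev inequality `∫ |u|^(pr) / |x|^β ≤ K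
[u]^(pr)`.

With `M = 𝒩(u)`, the function `W = |u|^p / (|x|^(a-β) M)` is a probability density. For `G =
|u|^(pr-p) |x|^(a-2β)` one has `W G = |u|^(pr) / (|x|^β M)`, and the logarithm in the theorem equals
`κ log G - log M`. Jensen and Hardy–Sobolev bound the left-hand side by `κ log (K [u]^(pr) / M) -
log M`. Since `κ r = κ + 1 = (Q - β)/(a - β)`, this is the right-hand side with `C = K^(1/r)`.

Hardy–Sobolev is proved on level sets `E_k = {2^k < |u|}`, of measure `a_k`. For `y ∈ E_{k+1}` and
`x ∉ E_k` the increment of `u` exceeds `2^k`, and the kernel integrated over the complement of `E_k`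
is at least a multiple of `a_k^(-a/Q)`. Hence the Gagliardo energy controls `∑ 2^(kp) a_{k+1}
a_k^(-a/Q)`, which an absorption argument turns into `∑ 2^(kp) a_k^(1-a/Q)`. The weight is handled
by `∫_E |x|^(-β) ≲ |E|^(1-β/Q)`, and `ℓ^1 ⊂ ℓ^r` gives the power `r`.

The group enters only through measurability and positivity of the kernel and the fact that all
quasi-balls of radius `R`, at any centre, have volume `c R^Q`; no triangle inequality is needed. -/

/-! ### Dyadic series -/

/-- A geometric series over all dyadic scales below `d`. -/
theorem tsum_dyadic_lt_le {γ : ℝ} (hγ : 0 < γ) (d : ℝ) :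
    ∑' k : ℤ, (if (2 : ℝ) ^ k < d then ENNReal.ofReal (((2 : ℝ) ^ k) ^ γ) else 0) ≤
      ENNReal.ofReal ((1 - (2 : ℝ) ^ (-γ))⁻¹ * d ^ γ) := by
  rcases le_or_gt d 0 with hd | hd
  · have : ∀ k : ℤ, (if (2 : ℝ) ^ k < d then ENNReal.ofReal (((2 : ℝ) ^ k) ^ γ) else 0) = 0 :=
      fun k => if_neg (not_lt.2 (hd.trans (by positivity)))
    simp [this]
  · obtain ⟨n, hn1, hn2⟩ := exists_mem_Ioc_zpow hd (one_lt_two (α := ℝ))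
    have hr1 : (2 : ℝ) ^ (-γ) < 1 := Real.rpow_lt_one_of_one_lt_of_neg one_lt_two (by linarith)
    have hr0 : 0 < (2 : ℝ) ^ (-γ) := by positivity
    have hle : ∀ k : ℤ, (if (2 : ℝ) ^ k < d then ENNReal.ofReal (((2 : ℝ) ^ k) ^ γ) else 0) ≤
        (if k ≤ n then ENNReal.ofReal (((2 : ℝ) ^ k) ^ γ) else 0) := by
      intro k
      by_cases hk : (2 : ℝ) ^ k < d
      · have : k < n + 1 := (zpow_lt_zpow_iff_right₀ (one_lt_two (α := ℝ))).1 (hk.trans_le hn2)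
        rw [if_pos hk, if_pos (by omega)]
      · simp [hk]
    refine (ENNReal.tsum_le_tsum hle).trans ?_
    have hinj : Function.Injective (fun j : ℕ => n - (j : ℤ)) := fun i j h => by
      simp only at h; omega
    rw [← hinj.tsum_eq (f := fun k : ℤ => if k ≤ n then ENNReal.ofReal (((2 : ℝ) ^ k) ^ γ) else 0)]
    · have hterm : ∀ j : ℕ, (if n - (j : ℤ) ≤ n then
          ENNReal.ofReal (((2 : ℝ) ^ (n - (j : ℤ))) ^ γ) else 0) =
          ENNReal.ofReal (((2 : ℝ) ^ n) ^ γ) * ENNReal.ofReal ((2 : ℝ) ^ (-γ)) ^ j := by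
        intro j
        rw [if_pos (by omega), ← ENNReal.ofReal_pow hr0.le, ← ENNReal.ofReal_mul (by positivity)]
        congr 1
        rw [← Real.rpow_intCast, ← Real.rpow_intCast, ← Real.rpow_mul two_pos.le,
          ← Real.rpow_mul two_pos.le, ← Real.rpow_natCast, ← Real.rpow_mul two_pos.le,
          ← Real.rpow_add two_pos]
        congr 1; push_cast; ring
      simp_rw [hterm]
      rw [ENNReal.tsum_mul_left, ENNReal.tsum_geometric, ← ENNReal.ofReal_one,
        ← ENNReal.ofReal_sub _ hr0.le, ← ENNReal.ofReal_inv_of_pos (by linarith),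
        ← ENNReal.ofReal_mul (by positivity), mul_comm]
      have : 0 < 1 - (2 : ℝ) ^ (-γ) := by linarith
      gcongr
    · intro k hk
      have : k ≤ n := by
        by_contra h
        simp [h] at hk
      exact ⟨(n - k).toNat, by simp only; omega⟩

/-- If `c ≤ ε b`, then `c^θ` is small relative to `b^θ` and the choice of `ε` makes its coefficient
`1/2`, which can be absorbed. If `c > ε b`, then `c^(θ-1) ≤ (ε b)^(θ-1)` because the exponent is
negative. -/
theorem rpow_dyadic_step {p θ ε b c : ℝ} (hθ0 : 0 < θ) (hθ1 : θ < 1) (hε : 0 < ε)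
    (hεp : (2 : ℝ) ^ p * ε ^ θ = 1 / 2) (hc : 0 ≤ c) (hcb : c ≤ b) :
    (2 : ℝ) ^ p * c ^ θ ≤ 1 / 2 * b ^ θ + 2 ^ p * ε ^ (θ - 1) * (c * b ^ (θ - 1)) := by
  have hb := hc.trans hcb
  rcases hb.eq_or_lt with rfl | hb0
  · obtain rfl : c = 0 := le_antisymm hcb hc
    simp [Real.zero_rpow hθ0.ne']
  rcases le_or_gt c (ε * b) with h | h
  · have h1 : c ^ θ ≤ ε ^ θ * b ^ θ := by
      rw [← Real.mul_rpow hε.le hb]; exact Real.rpow_le_rpow hc h hθ0.le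
    have h2 : (2 : ℝ) ^ p * c ^ θ ≤ 1 / 2 * b ^ θ := by
      rw [← hεp, mul_assoc]; gcongr
    have : 0 ≤ 2 ^ p * ε ^ (θ - 1) * (c * b ^ (θ - 1)) := by positivity
    linarith
  · have hc0 : 0 < c := lt_trans (by positivity) h
    have h1 : c ^ (θ - 1) ≤ ε ^ (θ - 1) * b ^ (θ - 1) := by
      rw [← Real.mul_rpow hε.le hb]
      exact Real.rpow_le_rpow_of_nonpos (by positivity) h.le (by linarith)
    have h2 : c ^ θ = c * c ^ (θ - 1) := by
      rw [Real.rpow_sub_one hc0.ne']; field_simp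
    have h3 : 0 ≤ 1 / 2 * b ^ θ := by positivity
    have : (2 : ℝ) ^ p * c ^ θ ≤ 2 ^ p * ε ^ (θ - 1) * (c * b ^ (θ - 1)) := by
      rw [h2, mul_assoc ((2 : ℝ) ^ p)]
      have : c * c ^ (θ - 1) ≤ c * (ε ^ (θ - 1) * b ^ (θ - 1)) := by gcongr
      calc _ ≤ (2 : ℝ) ^ p * (c * (ε ^ (θ - 1) * b ^ (θ - 1))) := by gcongr
        _ = _ := by ring
    linarith

/-- Summability of `2^{kp} a_k^θ` is controlled by that of `2^{kp} a_{k+1} a_k^{θ-1}` for a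
nonincreasing sequence of weak `L^p` decay. -/
theorem exists_tsum_dyadic_rpow_le {p θ : ℝ} (hp : 0 < p) (hθ0 : 0 < θ) (hθ1 : θ < 1) :
    ∃ C : ℝ, 0 < C ∧ ∀ (a : ℤ → ℝ) (A : ℝ), (∀ k, 0 ≤ a k) → (∀ k, a (k + 1) ≤ a k) →
      (∀ k : ℤ, a k ≤ A * ((2 : ℝ) ^ k) ^ (-p)) →
      ∑' k : ℤ, ENNReal.ofReal (((2 : ℝ) ^ k) ^ p * a k ^ θ) ≤
        ENNReal.ofReal C *
          ∑' k : ℤ, ENNReal.ofReal (((2 : ℝ) ^ k) ^ p * (a (k + 1) * a k ^ (θ - 1))) := by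
  set ε : ℝ := (2 : ℝ) ^ (-(p + 1) / θ) with hε_def
  have hε : 0 < ε := by positivity
  have hεp : (2 : ℝ) ^ p * ε ^ θ = 1 / 2 := by
    rw [hε_def, ← Real.rpow_mul two_pos.le, ← Real.rpow_add two_pos, div_mul_cancel₀ _ hθ0.ne']
    rw [show p + -(p + 1) = -1 by ring, Real.rpow_neg_one]; norm_num
  set c : ℝ := 2 ^ p * ε ^ (θ - 1)
  have hc : 0 < c := by positivity
  refine ⟨2 * c, by positivity, fun a A ha0 hanti haA => ?_⟩
  set x : ℤ → ℝ≥0∞ := fun k => ENNReal.ofReal (((2 : ℝ) ^ k) ^ p * a k ^ θ) with hx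
  set y : ℤ → ℝ≥0∞ :=
    fun k => ENNReal.ofReal (((2 : ℝ) ^ k) ^ p * (a (k + 1) * a k ^ (θ - 1))) with hy
  have hA : 0 ≤ A := by
    have := (ha0 0).trans (haA 0); simpa using this
  have hstep : ∀ k, x (k + 1) ≤ 2⁻¹ * x k + ENNReal.ofReal c * y k := by
    intro k
    have h2 : (2⁻¹ : ℝ≥0∞) = ENNReal.ofReal (1 / 2) := by
      rw [one_div, ENNReal.ofReal_inv_of_pos two_pos]; simp
    have hak := ha0 k
    have hak1 := ha0 (k + 1)
    simp only [hx, hy]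
    rw [h2, ← ENNReal.ofReal_mul (by norm_num), ← ENNReal.ofReal_mul hc.le,
      ← ENNReal.ofReal_add (by positivity) (by positivity)]
    apply ENNReal.ofReal_le_ofReal
    have := rpow_dyadic_step hθ0 hθ1 hε hεp (ha0 (k + 1)) (hanti k)
    have e : ((2 : ℝ) ^ (k + 1)) ^ p = ((2 : ℝ) ^ k) ^ p * 2 ^ p := by
      rw [zpow_add_one₀ two_ne_zero, Real.mul_rpow (by positivity) two_pos.le]
    rw [e]
    calc _ = ((2 : ℝ) ^ k) ^ p * (2 ^ p * a (k + 1) ^ θ) := by ring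
      _ ≤ ((2 : ℝ) ^ k) ^ p * (1 / 2 * a k ^ θ + c * (a (k + 1) * a k ^ (θ - 1))) := by gcongr
      _ = _ := by ring
  -- Absorption requires a finite sum. Truncated from above, the series is dominated by `A^θ ∑
  -- 2^(kp(1-θ))`, geometric with positive exponent; this is the only use of the decay of `a`.
  have hfin : ∀ n : ℤ, ∑' k : ℤ, (if (2 : ℝ) ^ k < 2 ^ n then x k else 0) ≠ ⊤ := by
    intro n
    have hγ : 0 < p * (1 - θ) := mul_pos hp (by linarith)
    have hle : ∀ k : ℤ, (if (2 : ℝ) ^ k < 2 ^ n then x k else 0) ≤ ENNReal.ofReal (A ^ θ) *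
        (if (2 : ℝ) ^ k < 2 ^ n then ENNReal.ofReal (((2 : ℝ) ^ k) ^ (p * (1 - θ))) else 0) := by
      intro k
      split_ifs
      · rw [← ENNReal.ofReal_mul (by positivity)]
        apply ENNReal.ofReal_le_ofReal
        have h1 : a k ^ θ ≤ A ^ θ * ((2 : ℝ) ^ k) ^ (-p * θ) := by
          rw [Real.rpow_mul (by positivity), ← Real.mul_rpow hA (by positivity)]
          exact Real.rpow_le_rpow (ha0 k) (haA k) hθ0.le
        calc ((2 : ℝ) ^ k) ^ p * a k ^ θ
            ≤ ((2 : ℝ) ^ k) ^ p * (A ^ θ * ((2 : ℝ) ^ k) ^ (-p * θ)) := by gcongr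
          _ = A ^ θ * (((2 : ℝ) ^ k) ^ p * ((2 : ℝ) ^ k) ^ (-p * θ)) := by ring
          _ = _ := by
            rw [← Real.rpow_add (by positivity)]; congr 2; ring
      · simp
    refine ne_top_of_le_ne_top ?_ (ENNReal.tsum_le_tsum hle)
    rw [ENNReal.tsum_mul_left]
    exact ENNReal.mul_ne_top ENNReal.ofReal_ne_top
      (ne_top_of_le_ne_top ENNReal.ofReal_ne_top (tsum_dyadic_lt_le hγ _))
  have hbound : ∀ n : ℤ, ∑' k : ℤ, (if (2 : ℝ) ^ k < 2 ^ n then x k else 0) ≤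
      ENNReal.ofReal (2 * c) * ∑' k, y k := by
    intro n
    set X := ∑' k : ℤ, (if (2 : ℝ) ^ k < 2 ^ n then x k else 0) with hX
    -- Shift the index by one, then apply `hstep`; the truncation survives since `k + 1 < n` implies
    -- `k < n`.
    have h1 : X ≤ 2⁻¹ * X + ENNReal.ofReal c * ∑' k, y k := by
      calc X = ∑' k : ℤ, (if (2 : ℝ) ^ (k + 1) < 2 ^ n then x (k + 1) else 0) :=
            ((Equiv.addRight (1 : ℤ)).tsum_eq
              (fun k : ℤ => if (2 : ℝ) ^ k < 2 ^ n then x k else 0)).symm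
        _ ≤ ∑' k : ℤ, (2⁻¹ * (if (2 : ℝ) ^ k < 2 ^ n then x k else 0) +
              ENNReal.ofReal c * y k) := by
            refine ENNReal.tsum_le_tsum fun k => ?_
            by_cases h : (2 : ℝ) ^ (k + 1) < 2 ^ n
            · have h' : (2 : ℝ) ^ k < 2 ^ n :=
                lt_trans (zpow_lt_zpow_right₀ one_lt_two (by omega)) h
              rw [if_pos h, if_pos h']; exact hstep k
            · rw [if_neg h]; exact zero_le
        _ = _ := by rw [ENNReal.tsum_add, ENNReal.tsum_mul_left, ENNReal.tsum_mul_left]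
    have h2 : 2⁻¹ * X ≤ ENNReal.ofReal c * ∑' k, y k := by
      have hX2 : X = 2⁻¹ * X + 2⁻¹ * X := by
        rw [← add_mul, ENNReal.inv_two_add_inv_two, one_mul]
      have hne : 2⁻¹ * X ≠ ⊤ := ENNReal.mul_ne_top (ENNReal.inv_ne_top.2 two_ne_zero) (hfin n)
      exact (ENNReal.add_le_add_iff_left hne).1 (hX2.symm.le.trans h1)
    calc X = 2 * (2⁻¹ * X) := by
          rw [← mul_assoc, ENNReal.mul_inv_cancel two_ne_zero (by simp), one_mul]
      _ ≤ 2 * (ENNReal.ofReal c * ∑' k, y k) := by gcongr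
      _ = _ := by
        rw [ENNReal.ofReal_mul two_pos.le, mul_assoc]; simp
  rw [ENNReal.tsum_eq_iSup_sum]
  refine iSup_le fun s => ?_
  obtain ⟨M, hM⟩ := s.bddAbove
  refine le_trans ?_ (hbound (M + 1))
  refine le_trans (Finset.sum_le_sum fun k hk => ?_) (ENNReal.sum_le_tsum s)
  have : k ≤ M := hM hk
  rw [if_pos (zpow_lt_zpow_right₀ one_lt_two (by omega))]

/-- Write `x^r = x · x^(r-1)` and bound each term by the whole sum in the second factor. -/
theorem ENNReal.tsum_rpow_le_rpow_tsum {ι : Type*} (f : ι → ℝ≥0∞) {r : ℝ} (hr : 1 ≤ r) :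
    ∑' i, f i ^ r ≤ (∑' i, f i) ^ r := by
  have h : ∀ x : ℝ≥0∞, x ^ r = x * x ^ (r - 1) := fun x => by
    conv_lhs => rw [← add_sub_cancel 1 r]
    rw [ENNReal.rpow_add_of_nonneg _ _ zero_le_one (by linarith), ENNReal.rpow_one]
  rw [h (∑' i, f i), ← ENNReal.tsum_mul_right]
  refine ENNReal.tsum_le_tsum fun i => ?_
  rw [h (f i)]
  exact mul_le_mul_right (ENNReal.rpow_le_rpow (ENNReal.le_tsum i) (by linarith)) _

/-! ### Integrals of powers of a gauge whose balls have measure `c R^Q` -/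

section Regular

variable {X : Type*} [MeasurableSpace X] {μ : Measure X}

/-- A ball of measure `2 μ(E)` leaves measure at least `μ(E)` outside `E`, and there the kernel is
at least `R^(-γ)`. Positivity of `ρ` off `E` matters because `1 / 0 = 0`. -/
theorem le_lintegral_compl_kernel {ρ : X → ℝ} {c Q γ : ℝ}
    (hρ : Measurable ρ) (hc : 0 < c) (hQ : 0 < Q) (hγ : 0 < γ)
    (hball : ∀ R : ℝ, 0 < R → μ {y | ρ y < R} = ENNReal.ofReal (c * R ^ Q)) {E : Set X}
    (hE : MeasurableSet E) (h0 : μ E ≠ 0) (htop : μ E ≠ ⊤) (hpos : ∀ y ∉ E, 0 < ρ y) :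
    ENNReal.ofReal ((2 / c) ^ (-γ / Q) * (μ E).toReal ^ (1 - γ / Q)) ≤
      ∫⁻ y in Eᶜ, ENNReal.ofReal (1 / ρ y ^ γ) ∂μ := by
  set t := (μ E).toReal with ht
  have ht0 : 0 < t := ENNReal.toReal_pos h0 htop
  set R : ℝ := (2 / c * t) ^ (1 / Q) with hR
  have hR0 : 0 < R := by positivity
  have hRQ : c * R ^ Q = t + t := by
    rw [hR, ← Real.rpow_mul (by positivity), one_div_mul_cancel hQ.ne', Real.rpow_one]
    field_simp; ring
  have hRγ : R ^ (-γ) = (2 / c) ^ (-γ / Q) * t ^ (-γ / Q) := by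
    rw [hR, ← Real.rpow_mul (by positivity), ← Real.mul_rpow (by positivity) ht0.le]
    congr 1; ring
  have hvol : ENNReal.ofReal t ≤ μ ({y | ρ y < R} \ E) := by
    have := le_measure_sdiff (μ := μ) (s₁ := {y | ρ y < R}) (s₂ := E)
    rwa [hball R hR0, hRQ, ← ENNReal.ofReal_toReal htop, ← ht,
      ← ENNReal.ofReal_sub _ ht0.le, add_sub_cancel_right] at this
  calc ENNReal.ofReal ((2 / c) ^ (-γ / Q) * t ^ (1 - γ / Q))
      = ENNReal.ofReal (R ^ (-γ)) * ENNReal.ofReal t := by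
        rw [← ENNReal.ofReal_mul (by positivity), hRγ, mul_assoc, ← Real.rpow_add_one ht0.ne']
        congr 3; ring
    _ ≤ ENNReal.ofReal (R ^ (-γ)) * μ ({y | ρ y < R} \ E) := by gcongr
    _ ≤ ENNReal.ofReal (R ^ (-γ)) * (μ.restrict Eᶜ) {y | ρ y < R} := by
        rw [Measure.restrict_apply' hE.compl, Set.sdiff_eq]
    _ ≤ ENNReal.ofReal (R ^ (-γ)) *
          (μ.restrict Eᶜ) {y | ENNReal.ofReal (R ^ (-γ)) ≤ ENNReal.ofReal (1 / ρ y ^ γ)} := by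
        rw [Measure.restrict_apply' hE.compl, Measure.restrict_apply' hE.compl]
        refine mul_le_mul_right (measure_mono ?_) _
        rintro y ⟨hy, hyE⟩
        refine ⟨ENNReal.ofReal_le_ofReal ?_, hyE⟩
        have h := hpos y hyE
        rw [one_div, ← Real.rpow_neg h.le]
        exact Real.rpow_le_rpow_of_nonpos h (le_of_lt hy) (by linarith)
    _ ≤ _ := mul_meas_ge_le_lintegral (by fun_prop) _

/-- The set lies in balls of arbitrarily small measure. Thus the points where the weight takes the
default value of division by zero are negligible. -/
theorem measure_nonpos_eq_zero {ρ : X → ℝ} {c Q : ℝ} (hc : 0 < c) (hQ : 0 < Q)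
    (hball : ∀ R : ℝ, 0 < R → μ {y | ρ y < R} = ENNReal.ofReal (c * R ^ Q)) :
    μ {x | ρ x ≤ 0} = 0 := by
  have hle : ∀ δ : ℝ, 0 < δ → μ {x | ρ x ≤ 0} ≤ ENNReal.ofReal δ := by
    intro δ hδ
    have hR : 0 < (δ / c) ^ (1 / Q) := by positivity
    have h := hball _ hR
    rw [← Real.rpow_mul (by positivity), one_div_mul_cancel hQ.ne', Real.rpow_one,
      mul_div_cancel₀ _ hc.ne'] at h
    rw [← h]
    exact measure_mono fun x hx => lt_of_le_of_lt hx hR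
  by_contra h0
  have htop := ne_top_of_le_ne_top ENNReal.ofReal_ne_top (hle 1 one_pos)
  have ht := ENNReal.toReal_pos h0 htop
  have := ENNReal.toReal_le_of_le_ofReal (by positivity) (hle _ (half_pos ht))
  linarith

/-- Among sets of given measure, the integral of a negative power of a gauge with homogeneous balls
is controlled by its value on a ball. -/
theorem exists_setLIntegral_inv_rpow_le {ρ : X → ℝ} {c Q β : ℝ} (hρ : Measurable ρ) (hc : 0 < c)
    (hβ : 0 ≤ β) (hβQ : β < Q)
    (hball : ∀ R : ℝ, 0 < R → μ {y | ρ y < R} = ENNReal.ofReal (c * R ^ Q)) :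
    ∃ C : ℝ, 0 < C ∧ ∀ E : Set X, MeasurableSet E → μ E ≠ ⊤ →
      ∫⁻ x in E, ENNReal.ofReal (1 / ρ x ^ β) ∂μ ≤
        ENNReal.ofReal (C * (μ E).toReal ^ (1 - β / Q)) := by
  have hQ : 0 < Q := hβ.trans_lt hβQ
  have hγ : 0 < Q - β := by linarith
  have hC' : 0 < (1 - (2 : ℝ) ^ (-(Q - β)))⁻¹ := by
    have := Real.rpow_lt_one_of_one_lt_of_neg one_lt_two (neg_lt_zero.2 hγ)
    exact inv_pos.2 (by linarith)
  set C' : ℝ := (1 - (2 : ℝ) ^ (-(Q - β)))⁻¹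
  have hsmall : ∀ R : ℝ, ∫⁻ x in {x | ρ x < R}, ENNReal.ofReal (1 / ρ x ^ β) ∂μ ≤
      ENNReal.ofReal (c * 4 ^ Q * C' * R ^ (Q - β)) := by
    intro R
    have hm : ∀ r, MeasurableSet {x | ρ x < r} := fun r => measurableSet_lt hρ measurable_const
    -- The shell `2^k < ρ ≤ 2^(k+1)` is enlarged to the open ball of radius `2^(k+2)`, which is
    -- where `4 ^ Q` comes from.
    set F : ℤ → X → ℝ≥0∞ := fun k x =>
      (if (2 : ℝ) ^ k < R then ENNReal.ofReal (((2 : ℝ) ^ k) ^ (-β)) else 0) *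
        {x | ρ x < 2 ^ (k + 2)}.indicator 1 x with hF
    have hpt : ∀ᵐ x ∂μ, x ∈ {x | ρ x < R} → ENNReal.ofReal (1 / ρ x ^ β) ≤ ∑' k, F k x := by
      have h0 : ∀ᵐ x ∂μ, ¬ ρ x ≤ 0 := by
        simpa only [ae_iff, not_not] using measure_nonpos_eq_zero hc hQ hball
      filter_upwards [h0] with x hx hxR
      obtain ⟨k, hk1, hk2⟩ := exists_mem_Ioc_zpow (not_le.1 hx) (one_lt_two (α := ℝ))
      refine le_trans ?_ (ENNReal.le_tsum k)
      have h1 : x ∈ {x | ρ x < 2 ^ (k + 2)} :=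
        hk2.trans_lt (zpow_lt_zpow_right₀ one_lt_two (by omega))
      simp only [hF]
      rw [if_pos (hk1.trans hxR), Set.indicator_of_mem h1, Pi.one_apply, mul_one]
      apply ENNReal.ofReal_le_ofReal
      rw [one_div, ← Real.rpow_neg (not_le.1 hx).le]
      exact Real.rpow_le_rpow_of_nonpos (by positivity) hk1.le (by linarith)
    calc ∫⁻ x in {x | ρ x < R}, ENNReal.ofReal (1 / ρ x ^ β) ∂μ
        ≤ ∫⁻ x in {x | ρ x < R}, ∑' k, F k x ∂μ := setLIntegral_mono_ae' (hm R) hpt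
      _ ≤ ∫⁻ x, ∑' k, F k x ∂μ := setLIntegral_le_lintegral _ _
      _ = ∑' k, ∫⁻ x, F k x ∂μ := lintegral_tsum fun k =>
          (measurable_const.mul (measurable_one.indicator (hm _))).aemeasurable
      _ = ∑' k : ℤ, ENNReal.ofReal (c * 4 ^ Q) *
            (if (2 : ℝ) ^ k < R then ENNReal.ofReal (((2 : ℝ) ^ k) ^ (Q - β)) else 0) := by
          refine tsum_congr fun k => ?_
          simp only [hF]
          rw [lintegral_const_mul _ (measurable_one.indicator (hm _)),
            lintegral_indicator_one (hm _), hball _ (by positivity)]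
          split_ifs
          · rw [← ENNReal.ofReal_mul (by positivity), ← ENNReal.ofReal_mul (by positivity)]
            congr 1
            rw [zpow_add₀ two_ne_zero, Real.mul_rpow (by positivity) (by positivity),
              Real.rpow_sub (by positivity), Real.rpow_neg (by positivity)]
            norm_num
            field_simp
          · simp
      _ ≤ ENNReal.ofReal (c * 4 ^ Q) * ENNReal.ofReal (C' * R ^ (Q - β)) := by
          rw [ENNReal.tsum_mul_left]
          exact mul_le_mul_right (tsum_dyadic_lt_le hγ R) _
      _ = _ := by
          rw [← ENNReal.ofReal_mul (by positivity)]; congr 1; ring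
  refine ⟨c * 4 ^ Q * C' + 1, by positivity, fun E hE htop => ?_⟩
  rcases eq_or_ne (μ E) 0 with h0 | h0
  · rw [Measure.restrict_eq_zero.2 h0]; simp
  set t := (μ E).toReal with ht
  have ht0 : 0 < t := ENNReal.toReal_pos h0 htop
  -- Cut `E` at radius `t^(1/Q)`, whose ball has measure comparable to `t`: inside, `hsmall`
  -- applies; outside, the weight is at most its value at the cut. The outer part accounts for the
  -- `+ 1` in the constant.
  have hR : 0 < t ^ (1 / Q) := by positivity
  have e1 : (t ^ (1 / Q)) ^ (Q - β) = t ^ (1 - β / Q) := by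
    rw [← Real.rpow_mul ht0.le]; congr 1; field_simp
  have e2 : (t ^ (1 / Q)) ^ (-β) * t = t ^ (1 - β / Q) := by
    rw [← Real.rpow_mul ht0.le, ← Real.rpow_add_one ht0.ne']; congr 1; field_simp; ring
  have hlarge : ∫⁻ x in E \ {x | ρ x < t ^ (1 / Q)}, ENNReal.ofReal (1 / ρ x ^ β) ∂μ ≤
      ENNReal.ofReal (t ^ (1 - β / Q)) := by
    calc _ ≤ ∫⁻ x in E \ {x | ρ x < t ^ (1 / Q)}, ENNReal.ofReal ((t ^ (1 / Q)) ^ (-β)) ∂μ := by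
          refine setLIntegral_mono' (hE.diff (measurableSet_lt hρ measurable_const)) ?_
          rintro x ⟨-, hx⟩
          have hx : t ^ (1 / Q) ≤ ρ x := not_lt.1 hx
          apply ENNReal.ofReal_le_ofReal
          rw [one_div, ← Real.rpow_neg (hR.trans_le hx).le]
          exact Real.rpow_le_rpow_of_nonpos hR hx (by linarith)
      _ ≤ ENNReal.ofReal ((t ^ (1 / Q)) ^ (-β)) * μ E := by
          rw [setLIntegral_const]
          exact mul_le_mul_right (measure_mono Set.sdiff_subset) _
      _ = _ := by
          rw [← ENNReal.ofReal_toReal htop, ← ht, ← ENNReal.ofReal_mul (by positivity), e2]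
  rw [← lintegral_inter_add_sdiff _ E (measurableSet_lt hρ (measurable_const (a := t ^ (1 / Q))))]
  calc _ ≤ ENNReal.ofReal (c * 4 ^ Q * C' * t ^ (1 - β / Q)) +
          ENNReal.ofReal (t ^ (1 - β / Q)) := by
        rw [← e1]
        refine add_le_add ((lintegral_mono_set Set.inter_subset_right).trans (hsmall _)) ?_
        rw [e1]; exact hlarge
    _ = _ := by
        rw [← ENNReal.ofReal_add (by positivity) (by positivity)]; congr 1; ring

end Regular

/-! ### Fractional Hardy–Sobolev inequality by level sets -/

section Regular

variable {X : Type*} [MeasurableSpace X] {μ : Measure X}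

/-- For each pair of points, the dyadic levels separating `|u x|` from `|u y|` by a factor `2` are
controlled by the increment of `u`. -/
theorem tsum_dyadic_separated_le {p : ℝ} (hp : 0 < p) (s t : ℝ) :
    ∑' k : ℤ, (if (2 : ℝ) ^ (k + 1) < |t| ∧ |s| ≤ 2 ^ k then ENNReal.ofReal (((2 : ℝ) ^ k) ^ p)
      else 0) ≤ ENNReal.ofReal ((1 - (2 : ℝ) ^ (-p))⁻¹ * |s - t| ^ p) := by
  refine le_trans (ENNReal.tsum_le_tsum fun k => ?_) (tsum_dyadic_lt_le hp |s - t|)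
  split_ifs with h1 h2 h2
  · exact le_rfl
  · refine absurd ?_ h2
    have h3 := abs_sub_abs_le_abs_sub t s
    rw [abs_sub_comm t s] at h3
    have h4 := h1.1
    rw [zpow_add_one₀ two_ne_zero] at h4
    linarith [h1.2]
  · exact zero_le
  · exact le_rfl

/-- Summing the kernel lower bound over the dyadic level sets of `u`. -/
theorem exists_tsum_level_le_gagliardo {D : X → X → ℝ} {c Q p a : ℝ} [SFinite μ]
    (hD : Measurable (Function.uncurry D)) (hDpos : ∀ x y, x ≠ y → 0 < D x y)
    (hc : 0 < c) (ha : 0 < a) (haQ : a < Q) (hp : 0 < p)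
    (hball : ∀ x, ∀ R : ℝ, 0 < R → μ {y | D x y < R} = ENNReal.ofReal (c * R ^ Q)) :
    ∃ C : ℝ, 0 < C ∧ ∀ u : X → ℝ, Measurable u → (∀ k : ℤ, μ {x | (2 : ℝ) ^ k < |u x|} ≠ ⊤) →
      ∑' k : ℤ, ENNReal.ofReal (((2 : ℝ) ^ k) ^ p * ((μ {x | (2 : ℝ) ^ (k + 1) < |u x|}).toReal *
        (μ {x | (2 : ℝ) ^ k < |u x|}).toReal ^ ((1 - a / Q) - 1))) ≤ ENNReal.ofReal C *
      ∫⁻ y, ∫⁻ x, ENNReal.ofReal (|u x - u y| ^ p / D y x ^ (Q + a)) ∂μ ∂μ := by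
  have hQ : 0 < Q := ha.trans haQ
  have hC' : 0 < (1 - (2 : ℝ) ^ (-p))⁻¹ := by
    have := Real.rpow_lt_one_of_one_lt_of_neg one_lt_two (neg_lt_zero.2 hp)
    exact inv_pos.2 (by linarith)
  set C' : ℝ := (1 - (2 : ℝ) ^ (-p))⁻¹
  set c₁ : ℝ := (2 / c) ^ (-(Q + a) / Q) with hc₁
  have hc₁0 : 0 < c₁ := by positivity
  refine ⟨c₁⁻¹ * C', by positivity, fun u hu hfin => ?_⟩
  have hE : ∀ k : ℤ, MeasurableSet {x | (2 : ℝ) ^ k < |u x|} := fun k =>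
    measurableSet_lt measurable_const (by fun_prop)
  set F : ℤ → X → X → ℝ≥0∞ := fun k y x =>
    (if (2 : ℝ) ^ (k + 1) < |u y| ∧ |u x| ≤ 2 ^ k then ENNReal.ofReal (((2 : ℝ) ^ k) ^ p) else 0) *
      ENNReal.ofReal (1 / D y x ^ (Q + a)) with hF
  have hFm : ∀ k, Measurable (Function.uncurry (F k)) := by
    intro k
    refine Measurable.mul (Measurable.ite ?_ measurable_const measurable_const) ?_
    · exact (measurableSet_lt measurable_const (hu.comp measurable_fst).abs).inter
        (measurableSet_le (hu.comp measurable_snd).abs measurable_const)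
    · exact ENNReal.measurable_ofReal.comp (measurable_const.div (hD.pow_const _))
  -- For fixed `y ∈ E'`, the kernel bound around `y` with `γ = Q + a` gives the power `1 - γ/Q =
  -- -a/Q` of the measure of `E`; integrating over `y` supplies the factor `μ(E')`.
  have hlow : ∀ k : ℤ, ENNReal.ofReal c₁ * ENNReal.ofReal (((2 : ℝ) ^ k) ^ p *
      ((μ {x | (2 : ℝ) ^ (k + 1) < |u x|}).toReal *
        (μ {x | (2 : ℝ) ^ k < |u x|}).toReal ^ ((1 - a / Q) - 1))) ≤ ∫⁻ y, ∫⁻ x, F k y x ∂μ ∂μ := by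
    intro k
    set E := {x | (2 : ℝ) ^ k < |u x|} with hEdef
    set E' := {x | (2 : ℝ) ^ (k + 1) < |u x|} with hE'def
    have hsub : E' ⊆ E := fun x hx =>
      lt_trans (zpow_lt_zpow_right₀ (one_lt_two (α := ℝ)) (lt_add_one k)) hx
    rcases eq_or_ne (μ E) 0 with h0 | h0
    · rw [measure_mono_null hsub h0]; simp
    have hinner : ∀ y ∈ E', ENNReal.ofReal (((2 : ℝ) ^ k) ^ p) *
        ENNReal.ofReal (c₁ * (μ E).toReal ^ ((1 - a / Q) - 1)) ≤ ∫⁻ x, F k y x ∂μ := by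
      intro y hy
      have hDy : Measurable (D y) := hD.comp (measurable_const.prodMk measurable_id)
      have hk := le_lintegral_compl_kernel (γ := Q + a) hDy
        hc hQ (by linarith) (hball y) (hE k) h0 (hfin k)
        (fun x hx => hDpos y x fun h => hx (h ▸ hsub hy))
      have e : (1 - a / Q) - 1 = 1 - (Q + a) / Q := by field_simp; ring
      rw [e]
      refine (mul_le_mul_right hk _).trans ?_
      rw [← lintegral_const_mul', ← lintegral_indicator (hE k).compl]
      · refine lintegral_mono fun x => ?_
        by_cases hx : x ∈ E
        · rw [Set.indicator_of_notMem (Set.notMem_compl_iff.2 hx)]; exact zero_le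
        · rw [Set.indicator_of_mem hx]
          simp only [hF]
          rw [if_pos ⟨hy, not_lt.1 hx⟩]
      · exact ENNReal.ofReal_ne_top
    calc _ = ENNReal.ofReal (((2 : ℝ) ^ k) ^ p) *
          ENNReal.ofReal (c₁ * (μ E).toReal ^ ((1 - a / Q) - 1)) * μ E' := by
          rw [← ENNReal.ofReal_toReal (hfin (k + 1)), ← ENNReal.ofReal_mul (by positivity),
            ← ENNReal.ofReal_mul (by positivity), ← ENNReal.ofReal_mul (by positivity),
            ENNReal.toReal_ofReal ENNReal.toReal_nonneg]
          congr 1; ring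
      _ = ∫⁻ y in E', ENNReal.ofReal (((2 : ℝ) ^ k) ^ p) *
          ENNReal.ofReal (c₁ * (μ E).toReal ^ ((1 - a / Q) - 1)) ∂μ := by
          rw [setLIntegral_const]
      _ ≤ ∫⁻ y in E', ∫⁻ x, F k y x ∂μ ∂μ := setLIntegral_mono' (hE (k + 1)) hinner
      _ ≤ _ := setLIntegral_le_lintegral _ _
  have hup : ∑' k, ∫⁻ y, ∫⁻ x, F k y x ∂μ ∂μ ≤ ENNReal.ofReal C' *
      ∫⁻ y, ∫⁻ x, ENNReal.ofReal (|u x - u y| ^ p / D y x ^ (Q + a)) ∂μ ∂μ := by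
    rw [← lintegral_tsum fun k => (hFm k).lintegral_prod_right.aemeasurable,
      ← lintegral_const_mul' _ _ ENNReal.ofReal_ne_top]
    refine lintegral_mono fun y => ?_
    have hFy : ∀ k, Measurable (F k y) := fun k =>
      (hFm k).comp (measurable_const.prodMk measurable_id)
    rw [← lintegral_tsum fun k => (hFy k).aemeasurable,
      ← lintegral_const_mul' _ _ ENNReal.ofReal_ne_top]
    refine lintegral_mono fun x => ?_
    simp only [hF]
    rw [ENNReal.tsum_mul_right]
    refine (mul_le_mul_left (tsum_dyadic_separated_le hp (u x) (u y)) _).trans ?_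
    rw [← ENNReal.ofReal_mul (by positivity), ← ENNReal.ofReal_mul hC'.le]
    apply le_of_eq; congr 1; ring
  have htot := (ENNReal.tsum_le_tsum hlow).trans hup
  rw [ENNReal.tsum_mul_left] at htot
  calc _ = ENNReal.ofReal c₁⁻¹ * (ENNReal.ofReal c₁ * ∑' k : ℤ, ENNReal.ofReal (((2 : ℝ) ^ k) ^ p *
      ((μ {x | (2 : ℝ) ^ (k + 1) < |u x|}).toReal *
        (μ {x | (2 : ℝ) ^ k < |u x|}).toReal ^ ((1 - a / Q) - 1)))) := by
        rw [← mul_assoc, ← ENNReal.ofReal_mul (by positivity), inv_mul_cancel₀ hc₁0.ne',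
          ENNReal.ofReal_one, one_mul]
    _ ≤ _ := by
        rw [ENNReal.ofReal_mul (by positivity), mul_assoc]
        exact mul_le_mul_right htot _

/-- The fractional Hardy–Sobolev inequality on a space whose balls have measure `c R ^ Q`. -/
theorem exists_fractional_hardy_sobolev {ρ : X → ℝ} {D : X → X → ℝ} {c Q p a β : ℝ} [SFinite μ]
    (hρ : Measurable ρ) (hρ0 : ∀ x, 0 ≤ ρ x)
    (hD : Measurable (Function.uncurry D)) (hDpos : ∀ x y, x ≠ y → 0 < D x y)
    (hc : 0 < c) (hβ : 0 ≤ β) (hβa : β < a) (haQ : a < Q) (hp : 0 < p)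
    (hρball : ∀ R : ℝ, 0 < R → μ {y | ρ y < R} = ENNReal.ofReal (c * R ^ Q))
    (hball : ∀ x, ∀ R : ℝ, 0 < R → μ {y | D x y < R} = ENNReal.ofReal (c * R ^ Q)) :
    ∃ K : ℝ, 0 < K ∧ ∀ u : X → ℝ, Measurable u → ∫⁻ x, ENNReal.ofReal (|u x| ^ p) ∂μ ≠ ⊤ →
      ∫⁻ x, ENNReal.ofReal (|u x| ^ (p * ((Q - β) / (Q - a))) / ρ x ^ β) ∂μ ≤ ENNReal.ofReal K *
      (∫⁻ y, ∫⁻ x, ENNReal.ofReal (|u x - u y| ^ p / D y x ^ (Q + a)) ∂μ ∂μ) ^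
        ((Q - β) / (Q - a)) := by
  have ha : 0 < a := hβ.trans_lt hβa
  have hQ : 0 < Q := ha.trans haQ
  set r : ℝ := (Q - β) / (Q - a) with hr
  have hQa : 0 < Q - a := by linarith
  have hr1 : 1 ≤ r := by rw [hr, one_le_div hQa]; linarith
  set θ : ℝ := 1 - a / Q with hθ
  have hθ0 : 0 < θ := by rw [hθ, sub_pos, div_lt_one hQ]; exact haQ
  have hθ1 : θ < 1 := by rw [hθ]; have : 0 < a / Q := by positivity
                         linarith
  have hθr : θ * r = 1 - β / Q := by rw [hθ, hr]; field_simp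
  obtain ⟨C₁, hC₁, h₁⟩ := exists_tsum_level_le_gagliardo hD hDpos hc ha haQ hp hball
  obtain ⟨C₂, hC₂, h₂⟩ := exists_tsum_dyadic_rpow_le hp hθ0 hθ1
  obtain ⟨C₃, hC₃, h₃⟩ := exists_setLIntegral_inv_rpow_le hρ hc hβ (hβa.trans haQ) hρball
  refine ⟨2 ^ (p * r) * C₃ * (C₂ * C₁) ^ r, by positivity, fun u hu hint => ?_⟩
  set G := ∫⁻ y, ∫⁻ x, ENNReal.ofReal (|u x - u y| ^ p / D y x ^ (Q + a)) ∂μ ∂μ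
  set A := (∫⁻ x, ENNReal.ofReal (|u x| ^ p) ∂μ).toReal with hA
  have hE : ∀ k : ℤ, MeasurableSet {x | (2 : ℝ) ^ k < |u x|} := fun k =>
    measurableSet_lt measurable_const (by fun_prop)
  -- Chebyshev: membership in `L^p` gives the finiteness and decay that the absorption argument
  -- needs.
  have hcheb : ∀ k : ℤ, μ {x | (2 : ℝ) ^ k < |u x|} ≤
      ENNReal.ofReal (A * ((2 : ℝ) ^ k) ^ (-p)) := by
    intro k
    have h2 : 0 < ((2 : ℝ) ^ k) ^ p := by positivity
    have h := mul_meas_ge_le_lintegral (μ := μ) (f := fun x => ENNReal.ofReal (|u x| ^ p))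
      (by fun_prop) (ENNReal.ofReal (((2 : ℝ) ^ k) ^ p))
    have hsub : {x | (2 : ℝ) ^ k < |u x|} ⊆
        {x | ENNReal.ofReal (((2 : ℝ) ^ k) ^ p) ≤ ENNReal.ofReal (|u x| ^ p)} := fun x hx =>
      ENNReal.ofReal_le_ofReal (Real.rpow_le_rpow (by positivity) (le_of_lt hx) hp.le)
    calc _ = ENNReal.ofReal (((2 : ℝ) ^ k) ^ (-p)) * (ENNReal.ofReal (((2 : ℝ) ^ k) ^ p) *
            μ {x | (2 : ℝ) ^ k < |u x|}) := by
          rw [← mul_assoc, ← ENNReal.ofReal_mul (by positivity), ← Real.rpow_add (by positivity)]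
          simp
      _ ≤ ENNReal.ofReal (((2 : ℝ) ^ k) ^ (-p)) * ∫⁻ x, ENNReal.ofReal (|u x| ^ p) ∂μ :=
          mul_le_mul_right ((mul_le_mul_right (measure_mono hsub) _).trans h) _
      _ = _ := by
          rw [← ENNReal.ofReal_toReal hint, ← ENNReal.ofReal_mul (by positivity), mul_comm]
  have hfin : ∀ k : ℤ, μ {x | (2 : ℝ) ^ k < |u x|} ≠ ⊤ := fun k =>
    ne_top_of_le_ne_top ENNReal.ofReal_ne_top (hcheb k)
  have hA0 : 0 ≤ A := ENNReal.toReal_nonneg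
  have hS := h₂ (fun k => (μ {x | (2 : ℝ) ^ k < |u x|}).toReal) A
    (fun k => ENNReal.toReal_nonneg)
    (fun k => ENNReal.toReal_mono (hfin k) (measure_mono fun x hx =>
      lt_trans (zpow_lt_zpow_right₀ (one_lt_two (α := ℝ)) (lt_add_one k)) hx))
    (fun k => ENNReal.toReal_le_of_le_ofReal (by positivity) (hcheb k))
  have hSG := hS.trans (mul_le_mul_right (h₁ u hu hfin) _)
  rw [← mul_assoc, ← ENNReal.ofReal_mul hC₂.le] at hSG
  -- Only the level with `2^k < |u x| ≤ 2^(k+1)` is needed.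
  have hpt : ∀ x, ENNReal.ofReal (|u x| ^ (p * r) / ρ x ^ β) ≤
      ∑' k : ℤ, {x | (2 : ℝ) ^ k < |u x|}.indicator (fun x =>
        ENNReal.ofReal (((2 : ℝ) ^ (k + 1)) ^ (p * r)) * ENNReal.ofReal (1 / ρ x ^ β)) x := by
    intro x
    rcases eq_or_ne (u x) 0 with h0 | h0
    · rw [h0, abs_zero, Real.zero_rpow (by positivity)]; simp
    obtain ⟨k, hk1, hk2⟩ := exists_mem_Ioc_zpow (abs_pos.2 h0) (one_lt_two (α := ℝ))
    refine le_trans ?_ (ENNReal.le_tsum k)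
    rw [Set.indicator_of_mem (show x ∈ {x | (2 : ℝ) ^ k < |u x|} from hk1),
      ← ENNReal.ofReal_mul (by positivity), mul_one_div]
    apply ENNReal.ofReal_le_ofReal
    have := Real.rpow_nonneg (hρ0 x) β
    gcongr
  calc _ ≤ ∫⁻ x, ∑' k : ℤ, {x | (2 : ℝ) ^ k < |u x|}.indicator (fun x =>
        ENNReal.ofReal (((2 : ℝ) ^ (k + 1)) ^ (p * r)) * ENNReal.ofReal (1 / ρ x ^ β)) x ∂μ :=
        lintegral_mono hpt
    _ = ∑' k : ℤ, ENNReal.ofReal (((2 : ℝ) ^ (k + 1)) ^ (p * r)) *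
          ∫⁻ x in {x | (2 : ℝ) ^ k < |u x|}, ENNReal.ofReal (1 / ρ x ^ β) ∂μ := by
        rw [lintegral_tsum fun k => Measurable.aemeasurable
          (Measurable.indicator (by fun_prop) (hE k))]
        refine tsum_congr fun k => ?_
        rw [lintegral_indicator (hE k), lintegral_const_mul' _ _ ENNReal.ofReal_ne_top]
    _ ≤ ∑' k : ℤ, ENNReal.ofReal (2 ^ (p * r) * C₃) * ENNReal.ofReal (((2 : ℝ) ^ k) ^ p *
          (μ {x | (2 : ℝ) ^ k < |u x|}).toReal ^ θ) ^ r := by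
        refine ENNReal.tsum_le_tsum fun k => ?_
        refine (mul_le_mul_right (h₃ _ (hE k) (hfin k)) _).trans (le_of_eq ?_)
        rw [ENNReal.ofReal_rpow_of_nonneg (by positivity) (by linarith),
          ← ENNReal.ofReal_mul (by positivity), ← ENNReal.ofReal_mul (by positivity)]
        congr 1
        rw [Real.mul_rpow (by positivity) (by positivity), ← Real.rpow_mul (by positivity),
          ← Real.rpow_mul (by positivity), hθr, zpow_add_one₀ two_ne_zero,
          Real.mul_rpow (by positivity) (by positivity)]
        ring
    _ ≤ ENNReal.ofReal (2 ^ (p * r) * C₃) * (ENNReal.ofReal (C₂ * C₁) * G) ^ r := by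
        rw [ENNReal.tsum_mul_left]
        exact mul_le_mul_right ((ENNReal.tsum_rpow_le_rpow_tsum _ hr1).trans
          (ENNReal.rpow_le_rpow hSG (by linarith))) _
    _ = _ := by
        rw [ENNReal.mul_rpow_of_nonneg _ _ (by linarith),
          ENNReal.ofReal_rpow_of_nonneg (by positivity) (by linarith), ← mul_assoc,
          ← ENNReal.ofReal_mul (by positivity)]

end Regular

/-! ### Dilations, invariance of Lebesgue measure and quasi-balls -/

section HomogeneousGroup

open Filter Topology

variable {N : ℕ} {ν : Fin N → ℝ}

/-- The dilation as a continuous linear map. -/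
noncomputable def dilationCLM (ν : Fin N → ℝ) (r : ℝ) : RSpace N →L[ℝ] RSpace N :=
  LinearMap.toContinuousLinearMap
    { toFun := dilation ν r
      map_add' := fun x y => by ext i; simp [dilation, mul_add]
      map_smul' := fun c x => by ext i; simp [dilation]; ring }

@[simp] theorem dilationCLM_apply (r : ℝ) (x : RSpace N) :
    dilationCLM ν r x = dilation ν r x := rfl

theorem dilation_dilation {r t : ℝ} (hr : 0 ≤ r) (ht : 0 ≤ t) (x : RSpace N) :
    dilation ν r (dilation ν t x) = dilation ν (r * t) x := by
  ext i; simp [dilation, Real.mul_rpow hr ht, mul_assoc]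

theorem dilation_one (x : RSpace N) : dilation ν 1 x = x := by
  ext i; simp [dilation]

theorem continuous_dilation (hν : ∀ i, 0 < ν i) (x : RSpace N) :
    Continuous fun r : ℝ => dilation ν r x := by
  unfold dilation
  refine (PiLp.continuous_toLp 2 _).comp (continuous_pi fun i => ?_)
  exact (Real.continuous_rpow_const (hν i).le).mul continuous_const

theorem dilation_zero (hν : ∀ i, 0 < ν i) (x : RSpace N) : dilation ν 0 x = 0 := by
  ext i; simp [dilation, Real.zero_rpow (hν i).ne']

theorem det_dilationCLM {r : ℝ} (hr : 0 < r) :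
    LinearMap.det (dilationCLM ν r : RSpace N →ₗ[ℝ] RSpace N) = r ^ homogeneousDim ν := by
  have h : LinearMap.toMatrix (EuclideanSpace.basisFun (Fin N) ℝ).toBasis
      (EuclideanSpace.basisFun (Fin N) ℝ).toBasis (dilationCLM ν r : RSpace N →ₗ[ℝ] RSpace N) =
      Matrix.diagonal fun i => r ^ ν i := by
    ext i j
    rw [LinearMap.toMatrix_apply]
    simp [dilation, Matrix.diagonal_apply]
  rw [← LinearMap.det_toMatrix (EuclideanSpace.basisFun (Fin N) ℝ).toBasis, h, Matrix.det_diagonal,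
    homogeneousDim, Real.rpow_sum_of_pos hr]

/-- An automorphism fixes the identity, while the dilation by `2` multiplies every coordinate by
`2^(ν i) > 1`. -/
theorem IsHomogeneousLieGroup.one_eq_zero [Group (RSpace N)] (hG : IsHomogeneousLieGroup N ν) :
    (1 : RSpace N) = 0 := by
  have h : dilation ν 2 (1 : RSpace N) = 1 := by
    have := hG.dilation_mul 2 two_pos 1 1
    rw [mul_one] at this
    exact left_eq_mul.1 this
  ext i
  have h1 : (2 : ℝ) ^ ν i * (1 : RSpace N) i = (1 : RSpace N) i := congrArg (fun x => x i) h
  have h2 : 1 < (2 : ℝ) ^ ν i := Real.one_lt_rpow one_lt_two (hG.weight_pos i)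
  have h3 : ((2 : ℝ) ^ ν i - 1) * (1 : RSpace N) i = 0 := by linarith
  simpa [sub_ne_zero.2 h2.ne'] using h3

theorem IsHomogeneousLieGroup.contDiff_mul [Group (RSpace N)] (hG : IsHomogeneousLieGroup N ν) :
    ContDiff ℝ ∞ fun z : RSpace N × RSpace N => z.1 * z.2 := by
  have := hG.lieGroup
  have h := ContMDiffMul.contMDiff_mul (I := 𝓘(ℝ, RSpace N)) (n := ∞) (G := RSpace N)
  rw [← modelWithCornersSelf_prod, chartedSpaceSelf_prod] at h
  exact h.contDiff

/-- A left translation has Jacobian `1`: the Jacobian is invariant under simultaneous dilation of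
both variables and equals `1` at the identity. -/
theorem IsHomogeneousLieGroup.det_fderiv_mul_left [Group (RSpace N)]
    (hG : IsHomogeneousLieGroup N ν) (g x : RSpace N) :
    (fderiv ℝ (fun y : RSpace N => g * y) x).det = 1 := by
  set J : RSpace N × RSpace N → ℝ :=
    fun z => (fderiv ℝ (fun y : RSpace N => z.1 * y) z.2).det with hJ
  have hsm : ∀ g : RSpace N, ContDiff ℝ ∞ fun y : RSpace N => g * y := fun g =>
    hG.contDiff_mul.comp (contDiff_const.prodMk contDiff_id)
  have hcont : Continuous J := by
    have h : ContDiff ℝ 0 fun z : RSpace N × RSpace N =>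
        fderiv ℝ (fun y : RSpace N => z.1 * y) z.2 :=
      ContDiff.fderiv (m := ∞) (n := 0) (f := fun (z : RSpace N × RSpace N) (y : RSpace N) => z.1 * y)
        (hG.contDiff_mul.comp ((contDiff_fst.comp contDiff_fst).prodMk contDiff_snd))
        contDiff_snd (by exact_mod_cast le_top)
    exact ContinuousLinearMap.continuous_det.comp h.continuous
  -- Differentiate `D_r(g y) = D_r(g) D_r(y)` in `y`; the determinant `r^Q` appears on both sides
  -- and cancels.
  have hinv : ∀ r : ℝ, 0 < r → J (dilation ν r g, dilation ν r x) = J (g, x) := by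
    intro r hr
    have hd : ∀ g y : RSpace N, HasFDerivAt (fun y : RSpace N => g * y)
        (fderiv ℝ (fun y : RSpace N => g * y) y) y := fun g y =>
      ((hsm g).differentiable (by norm_num)).differentiableAt.hasFDerivAt
    have h1 : HasFDerivAt ((fun y : RSpace N => dilation ν r g * y) ∘ dilationCLM ν r) _ x :=
      (hd (dilation ν r g) (dilation ν r x)).comp x (dilationCLM ν r).hasFDerivAt
    have h2 := (dilationCLM ν r).hasFDerivAt.comp x (hd g x)
    have heq : (fun y : RSpace N => dilation ν r g * y) ∘ dilationCLM ν r =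
        dilationCLM ν r ∘ fun y : RSpace N => g * y := by
      ext1 y; exact (hG.dilation_mul r hr g y).symm
    rw [heq] at h1
    have h3 := congrArg (fun A : RSpace N →L[ℝ] RSpace N => LinearMap.det (A : RSpace N →ₗ[ℝ] _))
      (h1.unique h2)
    simp only [ContinuousLinearMap.toLinearMap_comp, LinearMap.det_comp] at h3
    rw [mul_comm] at h3
    refine mul_left_cancel₀ ?_ h3
    rw [det_dilationCLM hr]; positivity
  have hlim : Tendsto (fun r : ℝ => J (dilation ν r g, dilation ν r x)) (𝓝[>] 0) (𝓝 (J (0, 0))) := by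
    have : Continuous fun r : ℝ => J (dilation ν r g, dilation ν r x) :=
      hcont.comp ((continuous_dilation hG.weight_pos g).prodMk
        (continuous_dilation hG.weight_pos x))
    have h := this.tendsto 0
    simp only [dilation_zero hG.weight_pos] at h
    exact h.mono_left nhdsWithin_le_nhds
  have h0 : J (0, 0) = 1 := by
    simp only [hJ]
    rw [← hG.one_eq_zero]
    simp [ContinuousLinearMap.det]
  have hconst : Tendsto (fun r : ℝ => J (dilation ν r g, dilation ν r x)) (𝓝[>] 0)
      (𝓝 (J (g, x))) := by
    refine tendsto_const_nhds.congr' ?_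
    filter_upwards [self_mem_nhdsWithin] with r hr using (hinv r hr).symm
  exact (tendsto_nhds_unique hconst hlim).trans h0

theorem IsHomogeneousLieGroup.volume_image_mul_left [Group (RSpace N)]
    (hG : IsHomogeneousLieGroup N ν) (g : RSpace N) {S : Set (RSpace N)} (hS : MeasurableSet S) :
    volume ((fun y => g * y) '' S) = volume S := by
  have hd : ∀ x ∈ S, HasFDerivWithinAt (fun y : RSpace N => g * y)
      (fderiv ℝ (fun y : RSpace N => g * y) x) S x := fun x _ =>
    (((hG.contDiff_mul.comp (contDiff_const.prodMk contDiff_id)).differentiable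
      (by norm_num)).differentiableAt.hasFDerivAt).hasFDerivWithinAt
  rw [← lintegral_abs_det_fderiv_eq_addHaar_image volume hS hd (mul_right_injective g).injOn]
  simp [hG.det_fderiv_mul_left]

theorem volume_image_dilation {r : ℝ} (hr : 0 < r) (S : Set (RSpace N)) :
    volume (dilation ν r '' S) = ENNReal.ofReal (r ^ homogeneousDim ν) * volume S := by
  have := Measure.addHaar_image_continuousLinearMap (volume : Measure (RSpace N))
    (dilationCLM ν r) S
  rw [det_dilationCLM hr, abs_of_pos (by positivity)] at this
  exact this

section QuasiNorm

variable [Group (RSpace N)] {m : RSpace N → ℝ}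

theorem IsHomogeneousQuasiNorm.image_dilation_ball (hm : IsHomogeneousQuasiNorm ν m) {r R : ℝ}
    (hr : 0 < r) : _root_.dilation ν r '' {x | m x < R} = {x | m x < r * R} := by
  ext x
  constructor
  · rintro ⟨y, hy, rfl⟩
    rw [Set.mem_ofPred_eq, hm.dilation r hr]
    exact mul_lt_mul_of_pos_left hy hr
  · intro hx
    refine ⟨_root_.dilation ν r⁻¹ x, ?_, ?_⟩
    · rw [Set.mem_ofPred_eq, hm.dilation _ (inv_pos.2 hr), inv_mul_lt_iff₀ hr]; exact hx
    · rw [dilation_dilation hr.le (inv_pos.2 hr).le, mul_inv_cancel₀ hr.ne', dilation_one]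

/-- Take `δ` to be the minimum of `m` on the Euclidean unit sphere. A point outside the unit ball is
carried to the sphere by some dilation with `r ≤ 1`, so its quasi-norm is at least `δ`. This makes
quasi-balls of finite volume. -/
theorem IsHomogeneousQuasiNorm.exists_ball_subset (hm : IsHomogeneousQuasiNorm ν m)
    (hν : ∀ i, 0 < ν i) :
    ∃ δ : ℝ, 0 < δ ∧ {x | m x < δ} ⊆ Metric.closedBall 0 1 := by
  -- The sphere is empty only when `N = 0`.
  rcases (Metric.sphere (0 : RSpace N) 1).eq_empty_or_nonempty with he | hne
  · refine ⟨1, one_pos, fun x _ => ?_⟩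
    by_contra hx
    rw [Metric.mem_closedBall, dist_zero_right, not_le] at hx
    have : ‖x‖⁻¹ • x ∈ Metric.sphere (0 : RSpace N) 1 := by
      rw [mem_sphere_zero_iff_norm, norm_smul, norm_inv, norm_norm,
        inv_mul_cancel₀ (by linarith)]
    rw [he] at this
    exact this
  · obtain ⟨z, hz, hmin⟩ := (isCompact_sphere (0 : RSpace N) 1).exists_isMinOn hne
      hm.continuous.continuousOn
    have hz0 : z ≠ 0 := by
      rintro rfl; simp at hz
    refine ⟨m z, (hm.nonneg z).lt_of_ne fun h => hz0 ((hm.eq_zero_iff z).1 h.symm), fun x hx => ?_⟩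
    by_contra hx1
    rw [Metric.mem_closedBall, dist_zero_right, not_le] at hx1
    have hc : ContinuousOn (fun r : ℝ => ‖_root_.dilation ν r x‖) (Set.Icc 0 1) :=
      (continuous_dilation hν x).norm.continuousOn
    obtain ⟨r, ⟨hr0, hr1⟩, hr⟩ := intermediate_value_Icc zero_le_one hc
      (show (1 : ℝ) ∈ _ by
        simp only [dilation_zero hν, dilation_one, norm_zero]; exact ⟨zero_le_one, hx1.le⟩)
    have hr0' : 0 < r := by
      refine hr0.lt_of_ne ?_
      rintro rfl
      simp [dilation_zero hν] at hr
    have h1 : m z ≤ m (_root_.dilation ν r x) := hmin (mem_sphere_zero_iff_norm.2 hr)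
    rw [hm.dilation r hr0'] at h1
    have h2 : r * m x ≤ 1 * m x := mul_le_mul_of_nonneg_right hr1 (hm.nonneg x)
    have h3 : m x < m z := hx
    linarith

theorem IsHomogeneousQuasiNorm.exists_volume_ball (hm : IsHomogeneousQuasiNorm ν m)
    (hν : ∀ i, 0 < ν i) :
    ∃ c : ℝ, 0 < c ∧ ∀ R : ℝ, 0 < R →
      volume {x | m x < R} = ENNReal.ofReal (c * R ^ homogeneousDim ν) := by
  obtain ⟨δ, hδ, hsub⟩ := hm.exists_ball_subset hν
  have htop : volume {x | m x < δ} ≠ ⊤ :=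
    ne_top_of_le_ne_top measure_closedBall_lt_top.ne (measure_mono hsub)
  have hpos : volume {x | m x < δ} ≠ 0 :=
    (IsOpen.measure_pos volume (isOpen_lt hm.continuous continuous_const)
      ⟨0, by rw [Set.mem_ofPred_eq, (hm.eq_zero_iff 0).2 rfl]; exact hδ⟩).ne'
  refine ⟨(volume {x | m x < δ}).toReal * (δ⁻¹) ^ homogeneousDim ν, ?_, fun R hR => ?_⟩
  · have := ENNReal.toReal_pos hpos htop
    positivity
  · have h := hm.image_dilation_ball (r := R * δ⁻¹) (R := δ) (by positivity)
    rw [inv_mul_cancel_right₀ hδ.ne'] at h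
    rw [← h, volume_image_dilation (by positivity), Real.mul_rpow hR.le (by positivity),
      mul_assoc, ENNReal.ofReal_mul ENNReal.toReal_nonneg, ENNReal.ofReal_toReal htop, mul_comm,
      mul_comm (R ^ _)]

theorem IsHomogeneousQuasiNorm.volume_translated_ball (hm : IsHomogeneousQuasiNorm ν m)
    (hG : IsHomogeneousLieGroup N ν) (y : RSpace N) (R : ℝ) :
    volume {x | m (y⁻¹ * x) < R} = volume {x | m x < R} := by
  rw [← hG.volume_image_mul_left y (isOpen_lt hm.continuous continuous_const).measurableSet]
  congr 1
  ext x
  constructor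
  · exact fun hx => ⟨y⁻¹ * x, hx, by simp⟩
  · rintro ⟨z, hz, rfl⟩
    simpa using hz

theorem IsHomogeneousQuasiNorm.measurable_kernel (hm : IsHomogeneousQuasiNorm ν m)
    (hG : IsHomogeneousLieGroup N ν) :
    Measurable fun z : RSpace N × RSpace N => m (z.1⁻¹ * z.2) := by
  have := hG.lieGroup
  have hinv : Continuous fun x : RSpace N => x⁻¹ :=
    (contMDiff_inv 𝓘(ℝ, RSpace N) ∞ (G := RSpace N)).continuous
  exact (hm.continuous.comp (hG.contDiff_mul.continuous.comp
    ((hinv.comp continuous_fst).prodMk continuous_snd))).measurable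

theorem IsHomogeneousQuasiNorm.kernel_pos (hm : IsHomogeneousQuasiNorm ν m)
    (hG : IsHomogeneousLieGroup N ν) {x y : RSpace N} (h : x ≠ y) : 0 < m (x⁻¹ * y) := by
  refine (hm.nonneg _).lt_of_ne fun h0 => h ?_
  have h1 := (hm.eq_zero_iff _).1 h0.symm
  rw [← hG.one_eq_zero, inv_mul_eq_one] at h1
  exact h1

end QuasiNorm

end HomogeneousGroup

/-! ### Jensen's inequality with values in the extended reals -/

theorem lintegral_ofReal_abs_rpow_eq {X : Type*} [MeasurableSpace X] {μ : Measure X} {p : ℝ}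
    (hp : 0 < p) {f : X → ℝ} (hf : MemLp f (ENNReal.ofReal p) μ) :
    ∫⁻ x, ENNReal.ofReal (|f x| ^ p) ∂μ =
      ENNReal.ofReal ((eLpNorm f (ENNReal.ofReal p) μ).toReal ^ p) := by
  have h0 : ENNReal.ofReal p ≠ 0 := (ENNReal.ofReal_pos.2 hp).ne'
  rw [← ENNReal.ofReal_rpow_of_nonneg ENNReal.toReal_nonneg hp.le,
    ENNReal.ofReal_toReal hf.2.ne, eLpNorm_eq_lintegral_rpow_enorm_toReal h0 ENNReal.ofReal_ne_top,
    ENNReal.toReal_ofReal hp.le, ← ENNReal.rpow_mul, one_div_mul_cancel hp.ne', ENNReal.rpow_one]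
  refine lintegral_congr fun x => ?_
  rw [Real.enorm_eq_ofReal_abs, ENNReal.ofReal_rpow_of_nonneg (abs_nonneg _) hp.le]

/-- Jensen's inequality for the logarithm, in a form that allows the left-hand side to be `-∞`. -/
theorem extendedIntegral_le_of_le_log_tangent {N : ℕ} {f W G : RSpace N → ℝ} {A κ b : ℝ}
    (hA : 0 < A) (hκ : 0 ≤ κ) (hf : AEMeasurable f) (hW : Integrable W) (hW1 : ∫ x, W x = 1)
    (hWG : Integrable fun x => W x * G x) (hWGA : ∫ x, W x * G x ≤ A)
    (hle : ∀ᵐ x, f x ≤ W x * (κ * (G x / A - 1 + Real.log A) + b)) :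
    (∫⁻ x, ENNReal.ofReal (f x)) < ⊤ ∧
      extendedIntegral f ≤ ((κ * Real.log A + b : ℝ) : EReal) := by
  -- The tangent line of `log` at `A` gives an integrable majorant, so no integrability of the
  -- logarithm itself is required.
  set H : RSpace N → ℝ := fun x => κ / A * (W x * G x) + (κ * (Real.log A - 1) + b) * W x with hH
  have hHint : Integrable H := (hWG.const_mul _).add (hW.const_mul _)
  have hfH : ∀ᵐ x, f x ≤ H x := by
    filter_upwards [hle] with x hx
    refine hx.trans (le_of_eq ?_)
    simp only [hH]; ring
  have hpos : (∫⁻ x, ENNReal.ofReal (f x)) < ⊤ := by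
    refine lt_of_le_of_lt (lintegral_mono_ae ?_) hHint.lintegral_lt_top
    filter_upwards [hfH] with x hx using ENNReal.ofReal_le_ofReal hx
  refine ⟨hpos, ?_⟩
  rcases eq_or_ne (∫⁻ x, ENNReal.ofReal (-f x)) ⊤ with htop | htop
  · rw [extendedIntegral, htop, EReal.coe_ennreal_top, EReal.sub_top]
    exact bot_le
  · have hfint : Integrable f := by
      refine ⟨hf.aestronglyMeasurable, ?_⟩
      rw [hasFiniteIntegral_iff_enorm]
      calc ∫⁻ x, ‖f x‖ₑ ≤ ∫⁻ x, (ENNReal.ofReal (f x) + ENNReal.ofReal (-f x)) := by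
            refine lintegral_mono fun x => ?_
            rw [Real.enorm_eq_ofReal_abs]
            rcases abs_cases (f x) with ⟨h, -⟩ | ⟨h, -⟩ <;> rw [h]
            exacts [le_self_add, le_add_self]
        _ = _ := lintegral_add_left' hf.ennreal_ofReal _
        _ < ⊤ := ENNReal.add_lt_top.2 ⟨hpos, htop.lt_top⟩
    rw [extendedIntegral_eq_integral f hfint, EReal.coe_le_coe_iff]
    calc ∫ x, f x ≤ ∫ x, H x := integral_mono_ae hfint hHint hfH
      _ = κ / A * (∫ x, W x * G x) + (κ * (Real.log A - 1) + b) := by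
          simp only [hH]
          rw [integral_add (hWG.const_mul _) (hW.const_mul _), integral_const_mul,
            integral_const_mul, hW1, mul_one]
      _ ≤ κ / A * A + (κ * (Real.log A - 1) + b) := by gcongr
      _ = _ := by field_simp; ring

/-! ### The logarithmic Hardy inequality -/

section HomogeneousGroup

variable {N : ℕ} {ν : Fin N → ℝ} [Group (RSpace N)] {m : RSpace N → ℝ}

/-- The fractional Hardy–Sobolev inequality on a homogeneous Lie group. -/
theorem IsHomogeneousLieGroup.exists_fractional_hardy_sobolev {p s β : ℝ}
    (hG : IsHomogeneousLieGroup N ν) (hm : IsHomogeneousQuasiNorm ν m)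
    (hp : 0 < p) (hβ0 : 0 ≤ β) (hβ : β < s * p) (hsp : s * p < homogeneousDim ν) :
    ∃ K : ℝ, 0 < K ∧ ∀ u : RSpace N → ℝ, MemLp u (ENNReal.ofReal p) volume →
      ∫⁻ x, ENNReal.ofReal
          (|u x| ^ (p * ((homogeneousDim ν - β) / (homogeneousDim ν - s * p))) / m x ^ β) ≤
        ENNReal.ofReal K * (gagliardoSeminorm ν m s p u ^ p) ^
          ((homogeneousDim ν - β) / (homogeneousDim ν - s * p)) := by
  obtain ⟨c, hc, hball⟩ := hm.exists_volume_ball hG.weight_pos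
  obtain ⟨K, hK, h⟩ := _root_.exists_fractional_hardy_sobolev (μ := (volume : Measure (RSpace N)))
    (ρ := m) (D := fun y x => m (y⁻¹ * x)) hm.continuous.measurable hm.nonneg
    (hm.measurable_kernel hG) (fun x y hxy => hm.kernel_pos hG hxy) hc hβ0 hβ hsp hp hball
    (fun y R hR => (hm.volume_translated_ball hG y R).trans (hball R hR))
  refine ⟨K, hK, fun u hu => ?_⟩
  -- Both sides depend only on the a.e. class of `u`, so a measurable representative suffices.
  obtain ⟨v, hv, huv⟩ := hu.1.aemeasurable
  have hvp : MemLp v (ENNReal.ofReal p) volume := hu.ae_eq huv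
  have h1 := h v hv (by rw [lintegral_ofReal_abs_rpow_eq hp hvp]; exact ENNReal.ofReal_ne_top)
  have e1 : ∫⁻ x, ENNReal.ofReal
      (|u x| ^ (p * ((homogeneousDim ν - β) / (homogeneousDim ν - s * p))) / m x ^ β) =
      ∫⁻ x, ENNReal.ofReal
      (|v x| ^ (p * ((homogeneousDim ν - β) / (homogeneousDim ν - s * p))) / m x ^ β) :=
    lintegral_congr_ae (by filter_upwards [huv] with x hx; rw [hx])
  have e2 : gagliardoSeminorm ν m s p u ^ p = ∫⁻ y, ∫⁻ x, ENNReal.ofReal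
      (|v x - v y| ^ p / m (y⁻¹ * x) ^ (homogeneousDim ν + s * p)) := by
    rw [gagliardoSeminorm, ← ENNReal.rpow_mul, one_div_mul_cancel hp.ne', ENNReal.rpow_one]
    refine lintegral_congr_ae ?_
    filter_upwards [huv] with y hy
    refine lintegral_congr_ae ?_
    filter_upwards [huv] with x hx
    rw [hx, hy]
  rw [e1, e2]
  exact h1

/-- For `y₀ > 0` the logarithm is exactly `κ log G - log M`, because `κ` times the exponents of `y₀`
and `x₀` in `G` gives `p` and `(Q - sp)(1 - β/(sp - β))`. Then `log G ≤ G/A - 1 + log A`. -/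
theorem logHardyIntegrand_le {p s β Q M A x₀ y₀ : ℝ} (hβ : β < s * p)
    (hsp : s * p < Q) (hM : 0 < M) (hA : 0 < A) (hx : 0 < x₀) (hy : 0 ≤ y₀) (hp : 0 < p) :
    y₀ ^ p / x₀ ^ (s * p - β) / M *
        Real.log (x₀ ^ ((Q - s * p) * (1 - β / (s * p - β))) * y₀ ^ p / M) ≤
      y₀ ^ p / x₀ ^ (s * p - β) / M * ((Q - s * p) / (s * p - β) *
        (y₀ ^ (p * ((Q - β) / (Q - s * p)) - p) * x₀ ^ (s * p - β - β) / A - 1 + Real.log A) +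
          -Real.log M) := by
  rcases hy.eq_or_lt with rfl | hy
  · simp [Real.zero_rpow hp.ne']
  have hα : 0 < s * p - β := by linarith
  have hQ : 0 < Q - s * p := by linarith
  refine mul_le_mul_of_nonneg_left ?_ (by positivity)
  set G := y₀ ^ (p * ((Q - β) / (Q - s * p)) - p) * x₀ ^ (s * p - β - β) with hG
  have hG0 : 0 < G := by positivity
  have hlogG : Real.log G = (p * ((Q - β) / (Q - s * p)) - p) * Real.log y₀ +
      (s * p - β - β) * Real.log x₀ := by
    rw [hG, Real.log_mul (by positivity) (by positivity), Real.log_rpow hy, Real.log_rpow hx]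
  have hlog : Real.log (x₀ ^ ((Q - s * p) * (1 - β / (s * p - β))) * y₀ ^ p / M) =
      (Q - s * p) / (s * p - β) * Real.log G + -Real.log M := by
    rw [Real.log_div (by positivity) hM.ne', Real.log_mul (by positivity) (by positivity),
      Real.log_rpow hx, Real.log_rpow hy, hlogG]
    field_simp
    ring
  have htan : Real.log G ≤ G / A - 1 + Real.log A := by
    have := Real.log_le_sub_one_of_pos (div_pos hG0 hA)
    rw [Real.log_div hG0.ne' hA.ne'] at this
    linarith
  rw [hlog]
  gcongr

end HomogeneousGroup

theorem theorem3p1 {N : ℕ} [Group (RSpace N)] (ν : Fin N → ℝ)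
    (hG : IsHomogeneousLieGroup N ν) (hQ : 3 ≤ homogeneousDim ν)
    (m : RSpace N → ℝ) (hm : IsHomogeneousQuasiNorm ν m)
    (p s β : ℝ) (hp : 1 < p) (hs0 : 0 < s) (hs1 : s < 1)
    (hβ0 : 0 ≤ β) (hβ : β < s * p) (hsp : s * p < homogeneousDim ν) :
    ∃ C : ℝ, 0 < C ∧ ∀ u : RSpace N → ℝ,
      MemFracSobolev ν m s p u →
      ¬ (u =ᵐ[volume] 0) →
      MemLp (weightedFun m s p β u) (ENNReal.ofReal p) volume →
        (∫⁻ x, ENNReal.ofReal (logHardyIntegrand ν m s p β u x)) < ⊤ ∧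
        extendedIntegral (logHardyIntegrand ν m s p β u) ≤
          (((homogeneousDim ν - β) / (s * p - β) *
            Real.log (C * ((gagliardoSeminorm ν m s p u).toReal ^ p /
              weightedNormPow m s p β u)) : ℝ) : EReal) := by
  have hp0 : 0 < p := by linarith
  obtain ⟨K, hK, hHS⟩ := hG.exists_fractional_hardy_sobolev hm hp0 hβ0 hβ hsp
  set Q := homogeneousDim ν with hQdef
  set r : ℝ := (Q - β) / (Q - s * p) with hr
  have hα : 0 < s * p - β := by linarith
  have hQa : 0 < Q - s * p := by linarith
  have hr0 : 0 < r := div_pos (by linarith) hQa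
  refine ⟨K ^ (1 / r), by positivity, fun u hu hu0 hw => ?_⟩
  have hm0 : ∀ᵐ x, 0 < m x := by
    obtain ⟨c, hc, hball⟩ := hm.exists_volume_ball hG.weight_pos
    have h : ∀ᵐ x, ¬ m x ≤ 0 := by
      simpa only [ae_iff, not_not] using measure_nonpos_eq_zero hc (by linarith) hball
    filter_upwards [h] with x hx using not_le.1 hx
  set g : ℝ := (gagliardoSeminorm ν m s p u).toReal ^ p with hg
  have hgE : gagliardoSeminorm ν m s p u ^ p = ENNReal.ofReal g := by
    rw [hg, ← ENNReal.ofReal_rpow_of_nonneg ENNReal.toReal_nonneg hp0.le,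
      ENNReal.ofReal_toReal hu.2.ne]
  have hHSu := hHS u hu.1
  rw [hgE] at hHSu
  have hum : AEMeasurable u := hu.1.1.aemeasurable
  have hmm : Measurable m := hm.continuous.measurable
  -- A vanishing seminorm would force `u = 0` a.e. by Hardy–Sobolev.
  have hg0 : 0 < g := by
    refine (show 0 ≤ g by positivity).lt_of_ne fun h => hu0 ?_
    rw [← h, ENNReal.ofReal_zero, ENNReal.zero_rpow_of_pos hr0, mul_zero, nonpos_iff_eq_zero,
      lintegral_eq_zero_iff' (by fun_prop)] at hHSu
    filter_upwards [hHSu, hm0] with x hx hmx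
    by_contra hux
    have : 0 < |u x| := abs_pos.2 hux
    have h2 : 0 < |u x| ^ (p * r) / m x ^ β := by positivity
    exact (ENNReal.ofReal_pos.2 h2).ne' hx
  set M : ℝ := weightedNormPow m s p β u with hM
  have hwM : ∫⁻ x, ENNReal.ofReal (|u x| ^ p / m x ^ (s * p - β)) = ENNReal.ofReal M := by
    rw [hM, weightedNormPow, ← lintegral_ofReal_abs_rpow_eq hp0 hw]
    refine lintegral_congr fun x => ?_
    have := hm.nonneg x
    rw [weightedFun, abs_div, Real.div_rpow (abs_nonneg _) (abs_nonneg _),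
      abs_of_nonneg (Real.rpow_nonneg this _), ← Real.rpow_mul this, div_mul_cancel₀ _ hp0.ne']
  have hM0 : 0 < M := by
    refine (show 0 ≤ M by rw [hM, weightedNormPow]; positivity).lt_of_ne fun h => hu0 ?_
    rw [← h, ENNReal.ofReal_zero, lintegral_eq_zero_iff' (by fun_prop)] at hwM
    filter_upwards [hwM, hm0] with x hx hmx
    by_contra hux
    have : 0 < |u x| := abs_pos.2 hux
    have h2 : 0 < |u x| ^ p / m x ^ (s * p - β) := by positivity
    exact (ENNReal.ofReal_pos.2 h2).ne' hx
  -- The Hardy–Sobolev bound for `∫ W G`, used as the tangency point of the logarithm.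
  set A : ℝ := K * g ^ r / M with hA
  have hA0 : 0 < A := by positivity
  set W : RSpace N → ℝ := fun x => |u x| ^ p / m x ^ (s * p - β) / M with hW
  set G : RSpace N → ℝ := fun x => |u x| ^ (p * r - p) * m x ^ (s * p - β - β) with hGdef
  have hW0 : ∀ x, 0 ≤ W x := fun x => by
    have := Real.rpow_nonneg (hm.nonneg x) (s * p - β)
    simp only [hW]; positivity
  have hWG0 : ∀ x, 0 ≤ W x * G x := fun x => by
    have := Real.rpow_nonneg (hm.nonneg x) (s * p - β - β)
    have := hW0 x
    simp only [hGdef]; positivity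
  have hWm : AEMeasurable W := by simp only [hW]; fun_prop
  have hGm : AEMeasurable G := by simp only [hGdef]; fun_prop
  have hWl : ∫⁻ x, ENNReal.ofReal (W x) = 1 := by
    calc _ = ∫⁻ x, ENNReal.ofReal M⁻¹ * ENNReal.ofReal (|u x| ^ p / m x ^ (s * p - β)) := by
          refine lintegral_congr fun x => ?_
          rw [← ENNReal.ofReal_mul (by positivity)]; congr 1; simp only [hW]; ring
      _ = 1 := by
          rw [lintegral_const_mul' _ _ ENNReal.ofReal_ne_top, hwM,
            ← ENNReal.ofReal_mul (by positivity), inv_mul_cancel₀ hM0.ne', ENNReal.ofReal_one]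
  have hWGl : ∫⁻ x, ENNReal.ofReal (W x * G x) ≤ ENNReal.ofReal A := by
    calc _ = ∫⁻ x, ENNReal.ofReal M⁻¹ * ENNReal.ofReal (|u x| ^ (p * r) / m x ^ β) := by
          refine lintegral_congr_ae ?_
          filter_upwards [hm0] with x hmx
          rw [← ENNReal.ofReal_mul (by positivity)]; congr 1; simp only [hW, hGdef]
          rcases (abs_nonneg (u x)).eq_or_lt with h0 | h0
          · rw [← h0, Real.zero_rpow hp0.ne', Real.zero_rpow (mul_pos hp0 hr0).ne']; simp
          · have e : m x ^ (s * p - β) = m x ^ (s * p - β - β) * m x ^ β := by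
              rw [← Real.rpow_add hmx, sub_add_cancel]
            rw [Real.rpow_sub h0, e]
            field_simp
      _ ≤ ENNReal.ofReal M⁻¹ * (ENNReal.ofReal K * ENNReal.ofReal g ^ r) := by
          rw [lintegral_const_mul' _ _ ENNReal.ofReal_ne_top]
          exact mul_le_mul_right hHSu _
      _ = _ := by
          rw [ENNReal.ofReal_rpow_of_pos hg0, ← ENNReal.ofReal_mul hK.le,
            ← ENNReal.ofReal_mul (by positivity), hA]
          congr 1; ring
  have hWint : Integrable W :=
    (lintegral_ofReal_ne_top_iff_integrable hWm.aestronglyMeasurable (ae_of_all _ hW0)).1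
      (by rw [hWl]; exact ENNReal.one_ne_top)
  have hWGint : Integrable fun x => W x * G x :=
    (lintegral_ofReal_ne_top_iff_integrable (hWm.mul hGm).aestronglyMeasurable
      (ae_of_all _ hWG0)).1 (ne_top_of_le_ne_top ENNReal.ofReal_ne_top hWGl)
  have hW1 : ∫ x, W x = 1 := by
    rw [integral_eq_lintegral_of_nonneg_ae (ae_of_all _ hW0) hWm.aestronglyMeasurable, hWl,
      ENNReal.toReal_one]
  have hWGA : ∫ x, W x * G x ≤ A := by
    rw [integral_eq_lintegral_of_nonneg_ae (ae_of_all _ hWG0) (hWm.mul hGm).aestronglyMeasurable]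
    exact ENNReal.toReal_le_of_le_ofReal hA0.le hWGl
  have hfm : AEMeasurable (logHardyIntegrand ν m s p β u) := by
    unfold logHardyIntegrand
    fun_prop
  have key := extendedIntegral_le_of_le_log_tangent (f := logHardyIntegrand ν m s p β u)
    (κ := (Q - s * p) / (s * p - β)) (b := -Real.log M) hA0 (by positivity) hfm hWint hW1 hWGint
    hWGA (by
      filter_upwards [hm0] with x hmx
      exact logHardyIntegrand_le hβ hsp hM0 hA0 hmx (abs_nonneg _) hp0)
  refine ⟨key.1, key.2.trans (le_of_eq ?_)⟩
  congr 1
  rw [hA, Real.log_div (by positivity) hM0.ne', Real.log_mul hK.ne' (by positivity),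
    Real.log_rpow hg0, Real.log_mul (by positivity) (by positivity), Real.log_rpow hK,
    Real.log_div hg0.ne' hM0.ne', hr]
  have : 0 < Q - β := by linarith
  field_simp
  ring
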